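/- \textbf{Broadcast against a single adversarial edge.} Consider the following \emph{adversarial CONGEST} model. The network is a finite simple graph $G=(V,E)$ with $n\ge 2$ nodes; the nodes have distinct identifiers bounded by a polynomial in $n$. All nodes run the same deterministic algorithm in synchronous rounds. Initially a node knows only its own identifier, the identifiers of its neighbours (that is, of its incident edges) and a common polynomial estimate $N$ of the number of nodes, $n\le N\le n^{O(1)}$; it knows neither the topology nor the diameter. In each round every node may send a message of $O(\log n)$ bits, possibly a different one, to each of its neighbours. A designated source $s\in V$ holds a message $m_0$ of $O(\log n)$ bits and starts the algorithm; every other node is asleep until it receives its first message, and there is no global clock. A set $F\subseteq E$ of at most one edge, fixed but unknown to the nodes, is controlled by a computationally unbounded, adaptive adversary, who knows the graph, the identifiers, the algorithm and $m_0$: in each round, depending on all messages sent in the network so far, it replaces what is delivered in each direction of the edge in $F$ by an arbitrary message of $O(\log n)$ bits, or by nothing. A node halts by producing an irrevocable output; a halted node sends nothing. Then there is a deterministic algorithm in this model such that for every $3$-edge-connected graph $G$ of diameter $D$, all identifiers, every estimate $N$, every source $s$, every message $m_0$, every $F\subseteq E$ with $|F|\le 1$ and every adaptive adversary controlling $F$,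 within $\widetilde{O}(D^2)=O(D^2\,\mathrm{poly}\log n)$ rounds every node $v$ has halted with an output $(m_0,d_v)$, where $d_v$ is a linear estimate of the diameter: $D\le d_v\le a\,D$ for an absolute constant $a$. The constants in the bandwidth $O(\log n)$ and in the round bound depend only on the constants in the polynomial bounds on the identifiers and on $N$ and in the $O(\log n)$ bound on the length of $m_0$. -/

import Mathlib

namespace AdvCongest

/-- Bit strings of length at most `b`: what one direction of an edge can carry in one round. -/
abbrev Msg (b : ℕ) : Type := {w : List Bool // w.length ≤ b}

/-- The initial knowledge of a node: its own identifier, the identifiers of its neighbours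
(equivalently, of its incident edges, an edge being named by the identifiers of its endpoints),
and, for the source only, the message to be broadcast. -/
structure LocalInput where
  ownId : ℕ
  nbrIds : Finset ℕ
  source : Option (List Bool)

/-- A deterministic distributed algorithm with bandwidth `b`, the same for all the nodes.
In each round a node sends to each neighbour (addressed by its identifier) a message or nothing,
as a function of its state, and then updates its state from the set of pairs
(identifier of the sending neighbour, received message). There is no access to a global clock.
`output` is the final decision (message, diameter estimate); a node that has decided has halted. -/
structure Protocol (b : ℕ) where
  State : Type
  init : LocalInput → State
  send : State → ℕ → Option (Msg b)
  recv : State → Set (ℕ × Msg b) → State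
  output : State → Option (List Bool × ℕ)

/-- The messages of one round: `x u v` is what is put on the edge from `u` towards `v`. -/
abbrev Traffic (V : Type*) (b : ℕ) := V → V → Option (Msg b)

/-- A computationally unbounded adaptive adversary. Given everything that the nodes have sent, in
the current round (head of the list) and in all the earlier rounds, it chooses what each direction
of each adversarial edge delivers in the current round. -/
abbrev Adversary (V : Type*) (b : ℕ) := List (Traffic V b) → Traffic V b

section Execution

variable {V : Type*} [Fintype V] {b : ℕ}

open Classical in
/-- The initial knowledge of `v` when `s` is the source with message `m₀`. -/
noncomputable def localInput (G : SimpleGraph V) (ident : V → ℕ) (s : V) (m₀ : List Bool) (v : V) :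
    LocalInput where
  ownId := ident v
  nbrIds := (Finset.univ.filter fun u => G.Adj v u).image ident
  source := if v = s then some m₀ else none

/-- The states of all the nodes; `none` is a node that is still asleep. -/
abbrev Config (V : Type*) (P : Protocol b) := V → Option P.State

/-- What the nodes send: nodes that are asleep or have halted send nothing. -/
def sent (P : Protocol b) (ident : V → ℕ) (c : Config V P) : Traffic V b := fun u v =>
  match c u with
  | none => none
  | some q =>
    match P.output q with
    | none => P.send q (ident v)
    | some _ => none

open Classical in
/-- What the edges deliver: the edges of `F` whatever the adversary wants, all others faithfully. -/
noncomputable def delivered (F : Set (Sym2 V)) (x bad : Traffic V b) : Traffic V b := fun u v =>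
  if s(u, v) ∈ F then bad u v else x u v

/-- The messages received by `v`, each with the identifier of the neighbour it comes from. -/
def inbox (G : SimpleGraph V) (ident : V → ℕ) (y : Traffic V b) (v : V) : Set (ℕ × Msg b) :=
  {p | ∃ u, G.Adj u v ∧ p.1 = ident u ∧ y u v = some p.2}

open Classical in
/-- The state change of a single node with initial knowledge `inp`. A sleeping node is woken up
by the first message that it receives; a node that has halted does not change any more. -/
noncomputable def nextState (P : Protocol b) (inp : LocalInput) (I : Set (ℕ × Msg b)) :
    Option P.State → Option P.State
  | none => if I = ∅ then none else some (P.recv (P.init inp) I)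
  | some q =>
    match P.output q with
    | none => some (P.recv q I)
    | some _ => some q

open Classical in
/-- The configuration after `r` rounds, with the list of the messages sent so far (latest round
first). At the start only the source is awake. -/
noncomputable def run (G : SimpleGraph V) (ident : V → ℕ) (P : Protocol b) (s : V)
    (m₀ : List Bool) (F : Set (Sym2 V)) (A : Adversary V b) :
    ℕ → Config V P × List (Traffic V b)
  | 0 => (fun v => if v = s then some (P.init (localInput G ident s m₀ v)) else none, [])
  | r + 1 =>
    let c := (run G ident P s m₀ F A r).1
    let hist := sent P ident c :: (run G ident P s m₀ F A r).2
    let y := delivered F (sent P ident c) (A hist)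
    (fun v => nextState P (localInput G ident s m₀ v) (inbox G ident y v) (c v), hist)

/-- After `r` rounds node `v` has halted with output message `m` and diameter estimate `d`. -/
def HaltedWith (G : SimpleGraph V) (ident : V → ℕ) (P : Protocol b) (s : V)
    (m₀ : List Bool) (F : Set (Sym2 V)) (A : Adversary V b) (r : ℕ) (v : V)
    (m : List Bool) (d : ℕ) : Prop :=
  ∃ q, (run G ident P s m₀ F A r).1 v = some q ∧ P.output q = some (m, d)

end Execution

end AdvCongest

/-!
Whether some source floods a node `v` is settled by cut sets: `v` keeps the set of those edges that
may separate it from every source, starting from all edges, or from none at a source. If a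
neighbour `u` truly reports the cut set `X`, then `v` may discard all edges outside `X ∪ {uv}`.
A lie can only come over the adversarial edge `e`, and `e` is the one edge that it cannot make `v`
discard. So if `v` ends up with the empty set, then a walk that avoids `e` leads from a source to
`v`. Conversely, `v` discards `f` as soon as a walk that avoids `e` and `f` has brought reports
to it; by 3-edge-connectivity there is such a walk of length at most `13 * D`. A cut set along a
walk of length `i` has at most `i` elements, so that an iteration of about `D` rounds suffices to
report it, and a flood takes `O(D ^ 2)` rounds.

Presence or absence of a flood transmits a bit reliably. In phase `j` the source floods to distance
`2 ^ j`, then the nodes that were not reached flood an alarm, and if the source hears no alarm, it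
sends its message, one flood for each bit and each of its values. If every node within distance
`3 * R + 2` of `s` in `G - e - f` has distance at most `R = 2 ^ j` in `G - e`, then all nodes have;
this is why silence certifies `D ≤ 2 * R`, although the alarm travels only `O(R)` far. The first
phase that succeeds has `2 ^ j ≤ 26 * D`.
-/

namespace AdvCongest

section Graph

variable {V : Type*} {G : SimpleGraph V} {e : Sym2 V}

lemma dist_le_or_of_walk (hH : (G.deleteEdges {e}).Connected) {u v : V} (w : G.Walk u v) :
    (G.deleteEdges {e}).dist u v ≤ w.length ∨ ∃ p q, e = s(p, q) ∧
      (G.deleteEdges {e}).dist u p ≤ w.length ∧ (G.deleteEdges {e}).dist q v ≤ w.length := by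
  induction w with
  | nil => simp
  | @cons a x c hax w ih =>
    rw [SimpleGraph.Walk.length_cons]
    by_cases he : s(a, x) = e
    · rcases ih with h | ⟨p, q, hpq, -, hq⟩
      · exact .inr ⟨a, x, he.symm, by simp, by omega⟩
      · rcases Sym2.eq_iff.1 (he.trans hpq) with ⟨rfl, rfl⟩ | ⟨rfl, rfl⟩
        · exact .inr ⟨a, x, hpq, by simp, by omega⟩
        · exact .inl (by omega)
    · have hadj : (G.deleteEdges {e}).Adj a x := by simp [hax, he]
      have hstep : ∀ z, (G.deleteEdges {e}).dist a z ≤ (G.deleteEdges {e}).dist x z + 1 :=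
        fun z => by
          have := hH.dist_triangle (u := a) (v := x) (w := z)
          rw [SimpleGraph.dist_eq_one_iff_adj.2 hadj] at this
          omega
      rcases ih with h | ⟨p, q, hpq, hp, hq⟩
      · exact .inl ((hstep _).trans (by omega))
      · exact .inr ⟨p, q, hpq, (hstep p).trans (by omega), by omega⟩

lemma exists_dist_eq (hG : G.Connected) {u v : V} {n : ℕ} (h : n ≤ G.dist u v) :
    ∃ x, G.dist u x = n := by
  obtain ⟨w, hw⟩ := hG.exists_walk_length_eq_dist u v
  refine ⟨w.getVert n, ?_⟩
  rw [← SimpleGraph.length_eq_dist_of_subwalk hw (w.isSubwalk_take n),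
    SimpleGraph.Walk.take_length]
  omega

/- The vertices at distances `R + 1` and `3 * R + 2` from `s` in `G - e` are both reached in `G`
through `e`. Then either they are close to the same endpoint of `e`, or one of them is close to an
endpoint that is close to `s`. -/
lemma dist_deleteEdges_le (hH : (G.deleteEdges {e}).Connected) {s y : V} {R : ℕ}
    (hball : ∀ x, (G.deleteEdges {e}).dist s x ≤ (G.deleteEdges {e}).dist s y → G.dist s x ≤ R) :
    (G.deleteEdges {e}).dist s y ≤ 3 * R + 1 := by
  set H := G.deleteEdges {e}
  have hle : H ≤ G := G.deleteEdges_le _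
  have hnear : ∀ x, H.dist s x ≤ H.dist s y → R < H.dist s x →
      ∃ p q, e = s(p, q) ∧ H.dist s p ≤ R ∧ H.dist q x ≤ R := by
    intro x hx hR
    obtain ⟨w, hw⟩ := (hH.mono hle).exists_walk_length_eq_dist s x
    have := hball x hx
    rcases dist_le_or_of_walk hH w with (h : H.dist s x ≤ w.length) | ⟨p, q, he, hp, hq⟩
    · omega
    · exact ⟨p, q, he, hp.trans (by omega), hq.trans (by omega)⟩
  by_contra! hy
  obtain ⟨x, hx⟩ := exists_dist_eq hH (u := s) (v := y) (n := R + 1) (by omega)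
  obtain ⟨p, q, he, -, hq⟩ := hnear y le_rfl (by omega)
  obtain ⟨p', q', he', hp', hq'⟩ := hnear x (by omega) (by omega)
  rcases Sym2.eq_iff.1 (he.symm.trans he') with ⟨rfl, rfl⟩ | ⟨rfl, rfl⟩
  · have := hH.dist_triangle (u := s) (v := x) (w := y)
    have := hH.dist_triangle (u := x) (v := q) (w := y)
    have := H.dist_comm (u := x) (v := q)
    omega
  · have := hH.dist_triangle (u := s) (v := q) (w := y)
    omega

lemma connected_deleteEdges_pair [Nonempty V] (hG : G.IsEdgeConnected 3) (e f : Sym2 V) :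
    ((G.deleteEdges {e}).deleteEdges {f}).Connected :=
  ((SimpleGraph.isEdgeConnected_add_one one_ne_zero).1
    ((SimpleGraph.isEdgeConnected_add_one two_ne_zero).1 hG e) f).connected one_ne_zero

lemma connected_deleteEdges_singleton [Nonempty V] (hG : G.IsEdgeConnected 3) (e : Sym2 V) :
    (G.deleteEdges {e}).Connected :=
  (connected_deleteEdges_pair hG e e).mono (SimpleGraph.deleteEdges_le _)

lemma dist_deleteEdges_pair_le [Finite V] [Nontrivial V] (hG : G.IsEdgeConnected 3) (e f : Sym2 V)
    (u v : V) : ((G.deleteEdges {e}).deleteEdges {f}).dist u v ≤ 13 * G.diam := by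
  have hc : G.Connected := hG.connected three_ne_zero
  have hD : G.diam ≠ 0 := SimpleGraph.connected_iff_diam_ne_zero.1 hc
  have h0 : ∀ x, G.dist u x ≤ G.diam := fun x =>
    SimpleGraph.dist_le_diam (SimpleGraph.connected_iff_ediam_ne_top.1 hc)
  have h1 : ∀ x, (G.deleteEdges {e}).dist u x ≤ 3 * G.diam + 1 := fun x =>
    dist_deleteEdges_le (connected_deleteEdges_singleton hG e) fun x _ => h0 x
  have h2 : ((G.deleteEdges {e}).deleteEdges {f}).dist u v ≤ 3 * (3 * G.diam + 1) + 1 :=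
    dist_deleteEdges_le (connected_deleteEdges_pair hG e f) fun x _ => h1 x
  omega

lemma dist_le_of_dist_deleteEdges_le (hH : (G.deleteEdges {e}).Connected) {s : V} {R : ℕ}
    (h : ∀ x, (G.deleteEdges {e}).dist s x ≤ 3 * R + 2 → G.dist s x ≤ R) (v : V) :
    G.dist s v ≤ R := by
  refine h v ?_
  by_contra! hv
  obtain ⟨y, hy⟩ := exists_dist_eq hH hv.le
  have := dist_deleteEdges_le (y := y) hH fun x hx => h x (by omega)
  omega

lemma diam_le_two_mul (hG : G.Connected) {s : V} {R : ℕ} (h : ∀ v, G.dist s v ≤ R) :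
    G.diam ≤ 2 * R := by
  have := hG.nonempty
  obtain ⟨u, v, huv⟩ := G.exists_dist_eq_diam
  calc G.diam = G.dist u v := huv.symm
    _ ≤ G.dist u s + G.dist s v := hG.dist_triangle
    _ ≤ R + R := add_le_add (G.dist_comm.trans_le (h u)) (h v)
    _ = 2 * R := (two_mul R).symm

end Graph

/-- A broadcast scheme is a sequence of channels, each of which floods one bit of information from
a set of sources. Edges are named by elements of `E`. A symbol `none` is idle and only wakes up the
receiver, `some none` marks the end of a list of edge names, and `some (some f)` is an entry of it.
`len p` is the number of iterations of channel `p`, `src inp p acc` says whether a node with input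
`inp` which has accepted in the channels `acc` is a source of channel `p`, and `res p acc` is its
decision before channel `p`. -/
structure Scheme (E : Type*) (b : ℕ) where
  edge : Sym2 ℕ → E
  enc : Option (Option E) → Msg b
  len : ℕ → ℕ
  len_pos : ∀ p, 0 < len p
  src : LocalInput → ℕ → Set ℕ → Prop
  res : ℕ → Set ℕ → Option (List Bool × ℕ)
  res_zero : ∀ acc, res 0 acc = none

/-- The state of a node: everything that it has learned. The entries of `log` from `time` on are
not yet known. -/
structure NodeState (b : ℕ) where
  inp : LocalInput
  time : ℕ
  log : ℕ → Set (ℕ × Msg b)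

namespace Scheme

variable {E : Type*} {b : ℕ} (C : Scheme E b)

/-- The number of rounds of an iteration of channel `p`. In the first and in the last one only idle
symbols are sent, as the clocks of neighbours may differ by one round. -/
def width (p : ℕ) : ℕ := C.len p + 3

/-- The local time at which channel `p` starts. -/
def startTime : ℕ → ℕ
  | 0 => 0
  | p + 1 => startTime p + C.len p * C.width p

/-- The local time at which iteration `i` of channel `p` starts. -/
def iterStart (p i : ℕ) : ℕ := C.startTime p + i * C.width p

/-- The channel in use at local time `n`. -/
def chan (n : ℕ) : ℕ := Nat.findGreatest (fun p => C.startTime p ≤ n) n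

/-- The iteration of the current channel at local time `n`. -/
def iter (n : ℕ) : ℕ := (n - C.startTime (C.chan n)) / C.width (C.chan n)

/-- The round of the current iteration at local time `n`. -/
def tick (n : ℕ) : ℕ := (n - C.startTime (C.chan n)) % C.width (C.chan n)

section Clock

lemma width_pos (p : ℕ) : 0 < C.width p := Nat.succ_pos _

lemma iterStart_succ (p i : ℕ) : C.iterStart p (i + 1) = C.iterStart p i + C.width p := by
  simp only [iterStart, Nat.succ_mul, Nat.add_assoc]

lemma iterStart_mono (p : ℕ) : Monotone (C.iterStart p) := fun _ _ h =>
  Nat.add_le_add_left (Nat.mul_le_mul_right _ h) _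

lemma iterStart_add_lt {p i t : ℕ} (hi : i < C.len p) (ht : t < C.width p) :
    C.iterStart p i + t < C.startTime (p + 1) :=
  calc C.iterStart p i + t < C.iterStart p (i + 1) := by rw [iterStart_succ]; omega
    _ ≤ C.startTime (p + 1) := C.iterStart_mono p hi

lemma startTime_strictMono : StrictMono C.startTime :=
  strictMono_nat_of_lt_succ fun p =>
    Nat.lt_add_of_pos_right (Nat.mul_pos (C.len_pos p) (C.width_pos p))

lemma startTime_add_le {p r n : ℕ} (h : ∀ q < r, C.len (p + q) ≤ n) :
    C.startTime (p + r) ≤ C.startTime p + r * (n * (n + 3)) := by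
  induction r with
  | zero => simp
  | succ r ih =>
    have hle := h r r.lt_succ_self
    calc C.startTime (p + r) + C.len (p + r) * C.width (p + r)
        ≤ C.startTime p + r * (n * (n + 3)) + n * (n + 3) :=
          Nat.add_le_add (ih fun q hq => h q (hq.trans r.lt_succ_self))
            (Nat.mul_le_mul hle (Nat.add_le_add_right hle 3))
      _ = C.startTime p + (r + 1) * (n * (n + 3)) := by ring

lemma startTime_chan_le (n : ℕ) : C.startTime (C.chan n) ≤ n :=
  Nat.findGreatest_spec (P := fun p => C.startTime p ≤ n) (Nat.zero_le n) (Nat.zero_le n)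

lemma lt_startTime_chan_succ (n : ℕ) : n < C.startTime (C.chan n + 1) := by
  by_contra! h
  have hle : C.chan n + 1 ≤ n := (C.startTime_strictMono.le_apply).trans h
  exact Nat.findGreatest_is_greatest (Nat.lt_succ_self _) hle h

lemma chan_eq {p n : ℕ} (h : C.startTime p ≤ n) (h' : n < C.startTime (p + 1)) :
    C.chan n = p := by
  have h1 := C.startTime_strictMono.lt_iff_lt.1 ((C.startTime_chan_le n).trans_lt h')
  have h2 := C.startTime_strictMono.lt_iff_lt.1 (h.trans_lt (C.lt_startTime_chan_succ n))
  omega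

lemma clock_eq {p i t : ℕ} (hi : i < C.len p) (ht : t < C.width p) :
    C.chan (C.iterStart p i + t) = p ∧ C.iter (C.iterStart p i + t) = i ∧
      C.tick (C.iterStart p i + t) = t := by
  have hchan : C.chan (C.iterStart p i + t) = p :=
    C.chan_eq ((Nat.le_add_right _ _).trans (Nat.le_add_right _ _)) (C.iterStart_add_lt hi ht)
  have hsub : C.iterStart p i + t - C.startTime p = i * C.width p + t := by
    rw [iterStart]
    omega
  refine ⟨hchan, ?_, ?_⟩
  · rw [iter, hchan, hsub, Nat.add_comm, Nat.add_mul_div_right _ _ (C.width_pos p),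
      Nat.div_eq_of_lt ht, Nat.zero_add]
  · rw [tick, hchan, hsub, Nat.mul_add_mod_self_right, Nat.mod_eq_of_lt ht]

lemma iter_lt_len (n : ℕ) : C.iter n < C.len (C.chan n) := by
  have := C.startTime_chan_le n
  have := C.lt_startTime_chan_succ n
  rw [startTime] at this
  exact Nat.div_lt_of_lt_mul (by rw [Nat.mul_comm]; omega)

lemma iterStart_iter_add_tick (n : ℕ) :
    C.iterStart (C.chan n) (C.iter n) + C.tick n = n := by
  have := Nat.div_add_mod' (n - C.startTime (C.chan n)) (C.width (C.chan n))
  have := C.startTime_chan_le n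
  rw [iterStart, iter, tick]
  omega

lemma exists_eq_iterStart_add (n : ℕ) :
    ∃ p i t, i < C.len p ∧ t < C.width p ∧ n = C.iterStart p i + t :=
  ⟨C.chan n, C.iter n, C.tick n, C.iter_lt_len n, Nat.mod_lt _ (C.width_pos _),
    (C.iterStart_iter_add_tick n).symm⟩

end Clock

/-- The names received in iteration `i` of channel `p`, with the ends of the lists. -/
def heard (J : ℕ → Set (ℕ × Msg b)) (p i : ℕ) : Set (ℕ × Option E) :=
  {a | ∃ c < C.width p, (a.1, C.enc (some a.2)) ∈ J (C.iterStart p i + c)}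

lemma heard_congr {J J' : ℕ → Set (ℕ × Msg b)} {p i : ℕ}
    (h : ∀ n < C.iterStart p (i + 1), J n = J' n) : C.heard J p i = C.heard J' p i := by
  ext a
  refine exists_congr fun c => and_congr_right fun hc => ?_
  rw [h _ (by rw [iterStart_succ]; omega)]

end Scheme

open Classical in
/-- The edges of the cut set `X` of the node `own` that no neighbour excludes. A neighbour `y` which
has completed a list `Z`, as recorded in `T`, excludes the edges that neither belong to `Z` nor
join `y` to `own`. -/
noncomputable def refineCut {E : Type*} (edge : Sym2 ℕ → E) (own : ℕ) (X : Finset E)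
    (T : Set (ℕ × Option E)) : Finset E :=
  X.filter fun f => ∀ y, (y, none) ∈ T → f = edge s(own, y) ∨ (y, some f) ∈ T

lemma mem_refineCut {E : Type*} {edge : Sym2 ℕ → E} {own : ℕ} {X : Finset E}
    {T : Set (ℕ × Option E)} {f : E} : f ∈ refineCut edge own X T ↔
      f ∈ X ∧ ∀ y, (y, none) ∈ T → f = edge s(own, y) ∨ (y, some f) ∈ T := by
  simp only [refineCut, Finset.mem_filter]

namespace Scheme

variable {E : Type*} [Fintype E] {b : ℕ} (C : Scheme E b) (inp : LocalInput)
  (J : ℕ → Set (ℕ × Msg b))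

open Classical in
/-- The cut set after `i` iterations of channel `p` of a node that entered it with `acc`. It
contains the adversarial edge unless this edge is avoided by some walk from a source. -/
noncomputable def cutFrom (acc : Set ℕ) (p : ℕ) : ℕ → Finset E
  | 0 => if C.src inp p acc then ∅ else Finset.univ
  | i + 1 => refineCut C.edge inp.ownId (cutFrom acc p i) (C.heard J p i)

/-- The channels before `p` in which a node has accepted. -/
def accepted : ℕ → Set ℕ
  | 0 => ∅
  | p + 1 => {r | r ∈ accepted p ∨ r = p ∧ C.cutFrom inp J (accepted p) p (C.len p) = ∅}

/-- The cut set after `i` iterations of channel `p` of a node with input `inp` that receives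
`J 0`, `J 1`, … -/
noncomputable def cut (p i : ℕ) : Finset E := C.cutFrom inp J (C.accepted inp J p) p i

/-- The symbol sent at local time `n`. In iteration `i`, a node lists its cut set if this has at
most `i` elements. -/
noncomputable def symbol (n : ℕ) : Option (Option E) :=
  if (C.cut inp J (C.chan n) (C.iter n)).card ≤ C.iter n ∧ 1 ≤ C.tick n ∧
      C.tick n ≤ C.len (C.chan n) + 1 then
    some (C.cut inp J (C.chan n) (C.iter n)).toList[C.tick n - 1]?
  else none

/-- The protocol that runs the channels one after the other. -/
noncomputable def protocol : Protocol b where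
  State := NodeState b
  init inp := ⟨inp, 0, fun _ => ∅⟩
  send q _ := some (C.enc (C.symbol q.inp q.log q.time))
  recv q I := ⟨q.inp, q.time + 1, Function.update q.log q.time I⟩
  output q := C.res (C.chan q.time) (C.accepted q.inp q.log (C.chan q.time))

variable {inp J}

lemma mem_accepted_iff {p r : ℕ} :
    r ∈ C.accepted inp J p ↔ r < p ∧ C.cut inp J r (C.len r) = ∅ := by
  induction p with
  | zero => simp [accepted]
  | succ p ih =>
    rw [accepted, Set.mem_ofPred_eq, ih, Nat.lt_succ_iff_lt_or_eq, or_and_right]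
    refine or_congr_right (and_congr_right ?_)
    rintro rfl
    rfl

lemma symbol_iterStart_add {p i t : ℕ} (hi : i < C.len p) (ht : t < C.width p) :
    C.symbol inp J (C.iterStart p i + t) =
      if (C.cut inp J p i).card ≤ i ∧ 1 ≤ t ∧ t ≤ C.len p + 1 then
        some (C.cut inp J p i).toList[t - 1]?
      else none := by
  obtain ⟨hp, hi, ht⟩ := C.clock_eq hi ht
  rw [symbol, hp, hi, ht]

lemma exists_of_symbol_eq_some {n : ℕ} {x : Option E} (h : C.symbol inp J n = some x) :
    ∃ p i j, i < C.len p ∧ j ≤ C.len p ∧ n = C.iterStart p i + (j + 1) ∧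
      (C.cut inp J p i).card ≤ i ∧ (C.cut inp J p i).toList[j]? = x := by
  obtain ⟨p, i, t, hi, ht, rfl⟩ := C.exists_eq_iterStart_add n
  rw [C.symbol_iterStart_add hi ht] at h
  split_ifs at h with hcond
  obtain ⟨j, rfl⟩ : ∃ j, t = j + 1 := ⟨t - 1, by omega⟩
  exact ⟨p, i, j, hi, by omega, rfl, hcond.1, Option.some.inj h⟩

section Congr

variable {J' : ℕ → Set (ℕ × Msg b)}

lemma cutFrom_congr {acc : Set ℕ} {p i : ℕ} (h : ∀ n < C.iterStart p i, J n = J' n) :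
    C.cutFrom inp J acc p i = C.cutFrom inp J' acc p i := by
  induction i with
  | zero => rfl
  | succ i ih =>
    rw [cutFrom, cutFrom, C.heard_congr h,
      ih fun n hn => h n (hn.trans_le (C.iterStart_mono p i.le_succ))]

lemma accepted_congr {p : ℕ} (h : ∀ n < C.startTime p, J n = J' n) :
    C.accepted inp J p = C.accepted inp J' p := by
  induction p with
  | zero => rfl
  | succ p ih =>
    rw [accepted, accepted, C.cutFrom_congr h,
      ih fun n hn => h n (hn.trans (C.startTime_strictMono p.lt_succ_self))]

lemma symbol_congr {n : ℕ} (h : ∀ t < n, J t = J' t) : C.symbol inp J n = C.symbol inp J' n := by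
  have hle : C.iterStart (C.chan n) (C.iter n) ≤ n := Nat.le.intro (C.iterStart_iter_add_tick n)
  have hcut : C.cut inp J (C.chan n) (C.iter n) = C.cut inp J' (C.chan n) (C.iter n) := by
    rw [cut, cut, C.accepted_congr fun t ht => h t (ht.trans_le (C.startTime_chan_le n)),
      C.cutFrom_congr fun t ht => h t (ht.trans_le hle)]
  rw [symbol, symbol, hcut]

end Congr

end Scheme

/-- Flooding from the sources `S` along the edges of `G`, of which all but `e` are faithful, for
`ℓ` iterations: `cut v i` is the cut set of `v` after `i` iterations, and `heard v i` collects the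
lists and their ends that `v` hears in iteration `i`. -/
structure IsFlood {V E : Type*} [Fintype E] (G : SimpleGraph V) (e : Sym2 V) (ident : V → ℕ)
    (edge : Sym2 ℕ → E) (S : Set V) (ℓ : ℕ) (cut : V → ℕ → Finset E)
    (heard : V → ℕ → Set (ℕ × Option E)) : Prop where
  cut_zero_of_mem : ∀ v ∈ S, cut v 0 = ∅
  cut_zero_of_notMem : ∀ v ∉ S, cut v 0 = Finset.univ
  cut_succ : ∀ v i, cut v (i + 1) = refineCut edge (ident v) (cut v i) (heard v i)
  exists_adj : ∀ v i a, a ∈ heard v i → ∃ u, G.Adj u v ∧ a.1 = ident u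
  none_mem_heard : ∀ u v i, (G.deleteEdges {e}).Adj u v → i < ℓ →
    ((ident u, none) ∈ heard v i ↔ (cut u i).card ≤ i)
  some_mem_heard : ∀ u v i f, (G.deleteEdges {e}).Adj u v → i < ℓ → (cut u i).card ≤ i →
    ((ident u, some f) ∈ heard v i ↔ f ∈ cut u i)

namespace IsFlood

variable {V E : Type*} [Fintype E] {G : SimpleGraph V} {e : Sym2 V} {ident : V → ℕ}
  {edge : Sym2 ℕ → E} {S : Set V} {ℓ : ℕ} {cut : V → ℕ → Finset E}
  {heard : V → ℕ → Set (ℕ × Option E)}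

lemma exists_dist_le_of_notMem_cut (hF : IsFlood G e ident edge S ℓ cut heard)
    (hG : (G.deleteEdges {e}).Connected) {v : V} {i : ℕ} (hi : i ≤ ℓ)
    (h : edge (e.map ident) ∉ cut v i) : ∃ u ∈ S, (G.deleteEdges {e}).dist u v ≤ i := by
  induction i generalizing v with
  | zero =>
    refine ⟨v, ?_, by simp⟩
    by_contra hv
    simp [hF.cut_zero_of_notMem v hv] at h
  | succ i ih =>
    simp only [hF.cut_succ, mem_refineCut, not_and_or, not_forall, not_or] at h
    rcases h with h | ⟨y, hy, hedge, hlist⟩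
    · obtain ⟨u, hu, huv⟩ := ih (by omega) h
      exact ⟨u, hu, by omega⟩
    · obtain ⟨x, hxv, hyx⟩ := hF.exists_adj v i _ hy
      obtain rfl : y = ident x := hyx
      have hadj : (G.deleteEdges {e}).Adj x v := by
        refine (SimpleGraph.deleteEdges_adj ..).2 ⟨hxv, fun he => hedge ?_⟩
        rw [← Set.mem_singleton_iff.1 he, Sym2.map_mk, Sym2.eq_swap]
      have hcard := (hF.none_mem_heard x v i hadj hi).1 hy
      obtain ⟨u, hu, hux⟩ :=
        ih (by omega) fun hx => hlist ((hF.some_mem_heard x v i _ hadj hi hcard).2 hx)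
      have := hG.dist_triangle (u := u) (v := x) (w := v)
      rw [SimpleGraph.dist_eq_one_iff_adj.2 hadj] at this
      exact ⟨u, hu, by omega⟩

lemma exists_dist_le_of_cut_eq_empty (hF : IsFlood G e ident edge S ℓ cut heard)
    (hG : (G.deleteEdges {e}).Connected) {v : V} (h : cut v ℓ = ∅) :
    ∃ u ∈ S, (G.deleteEdges {e}).dist u v ≤ ℓ :=
  hF.exists_dist_le_of_notMem_cut hG le_rfl (by simp [h])

lemma cut_antitone (hF : IsFlood G e ident edge S ℓ cut heard) (v : V) : Antitone (cut v) :=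
  antitone_nat_of_succ_le fun i f hf => by
    rw [hF.cut_succ] at hf
    exact (mem_refineCut.1 hf).1

lemma cut_succ_subset_insert [DecidableEq E] (hF : IsFlood G e ident edge S ℓ cut heard) {u v : V}
    {i : ℕ} (huv : (G.deleteEdges {e}).Adj u v) (hi : i < ℓ) (hu : (cut u i).card ≤ i) :
    cut v (i + 1) ⊆ insert (edge s(ident v, ident u)) (cut u i) := by
  intro f hf
  rw [hF.cut_succ, mem_refineCut] at hf
  rw [Finset.mem_insert, ← hF.some_mem_heard u v i f huv hi hu]
  exact hf.2 _ ((hF.none_mem_heard u v i huv hi).2 hu)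

lemma notMem_cut_of_walk (hF : IsFlood G e ident edge S ℓ cut heard) {H : SimpleGraph V}
    (hH : H ≤ G.deleteEdges {e}) {x : E} (hx : ∀ u v, H.Adj u v → edge s(ident u, ident v) ≠ x)
    {u v : V} (w : H.Walk u v) {i : ℕ} (hi : i + w.length ≤ ℓ) (hcard : (cut u i).card ≤ i)
    (hu : x ∉ cut u i) : x ∉ cut v (i + w.length) := by
  classical
  induction w generalizing i with
  | nil => exact hu
  | @cons u z v huz w ih =>
    rw [SimpleGraph.Walk.length_cons, Nat.add_comm w.length, ← Nat.add_assoc] at hi ⊢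
    have hsub := hF.cut_succ_subset_insert (hH huz) (by omega) hcard
    refine ih hi ?_ fun hz => ?_
    · have := Finset.card_le_card hsub
      have := Finset.card_insert_le (edge s(ident z, ident u)) (cut u i)
      omega
    · rcases Finset.mem_insert.1 (hsub hz) with h | h
      · exact hx z u huz.symm h.symm
      · exact hu h

lemma cut_eq_empty (hF : IsFlood G e ident edge S ℓ cut heard)
    (hedge : Function.Injective fun f : Sym2 V => edge (f.map ident)) {v : V}
    (hG : ∀ f, ((G.deleteEdges {e}).deleteEdges {f}).Connected)
    (h : ∀ f, ∃ u ∈ S, ((G.deleteEdges {e}).deleteEdges {f}).dist u v ≤ ℓ) : cut v ℓ = ∅ := by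
  rw [Finset.eq_empty_iff_forall_notMem]
  intro x
  obtain ⟨f, hf⟩ : ∃ f : Sym2 V, ∀ f', edge (f'.map ident) = x → f' = f := by
    by_cases hx : ∃ f : Sym2 V, edge (f.map ident) = x
    · obtain ⟨f, rfl⟩ := hx
      exact ⟨f, fun f' hf' => hedge hf'⟩
    · exact ⟨e, fun f' hf' => absurd ⟨f', hf'⟩ hx⟩
  obtain ⟨u, hu, huv⟩ := h f
  obtain ⟨w, hw⟩ := (hG f).exists_walk_length_eq_dist u v
  have hzero := hF.cut_zero_of_mem u hu
  have hx := hF.notMem_cut_of_walk (SimpleGraph.deleteEdges_le _) (x := x)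
    (fun a c hac hx => ((SimpleGraph.deleteEdges_adj ..).1 hac).2 (hf s(a, c) hx)) w (i := 0)
    (by omega) (by simp [hzero]) (by simp [hzero])
  exact fun hmem => hx (hF.cut_antitone v (by omega) hmem)

end IsFlood

/-- An execution of `P` with source `s` and message `m₀` in which all edges but `e` deliver
faithfully: `cfg t` is the configuration after `t` rounds, and `traffic t` is what the edges deliver
in the round after that. -/
structure Execution {V : Type*} [Fintype V] {b : ℕ} (P : Protocol b) (G : SimpleGraph V)
    (ident : V → ℕ) (s : V) (m₀ : List Bool) (e : Sym2 V) where
  cfg : ℕ → Config V P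
  traffic : ℕ → Traffic V b
  cfg_zero_source : cfg 0 s = some (P.init (localInput G ident s m₀ s))
  cfg_zero_of_ne : ∀ v, v ≠ s → cfg 0 v = none
  cfg_succ : ∀ t v, cfg (t + 1) v =
    nextState P (localInput G ident s m₀ v) (inbox G ident (traffic t) v) (cfg t v)
  traffic_eq_sent : ∀ t u v, s(u, v) ≠ e → traffic t u v = sent P ident (cfg t) u v

section Model

variable {V : Type*} {b : ℕ} {P : Protocol b} {ident : V → ℕ}

lemma nextState_ne_none {inp : LocalInput} {I : Set (ℕ × Msg b)} {c : Option P.State}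
    (h : c ≠ none ∨ I.Nonempty) : nextState P inp I c ≠ none := by
  cases c with
  | none => simp_all [nextState, Set.nonempty_iff_ne_empty]
  | some q => cases hq : P.output q <;> simp [nextState, hq]

lemma nextState_of_output_eq_none {inp : LocalInput} {I : Set (ℕ × Msg b)} {q : P.State}
    (hq : P.output q = none) : nextState P inp I (some q) = some (P.recv q I) := by
  simp [nextState, hq]

lemma nextState_of_output_eq_some {inp : LocalInput} {I : Set (ℕ × Msg b)} {q : P.State}
    {o : List Bool × ℕ} (hq : P.output q = some o) : nextState P inp I (some q) = some q := by
  simp [nextState, hq]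

lemma sent_of_eq_none {c : Config V P} {u : V} (hu : c u = none) (v : V) :
    sent P ident c u v = none := by
  simp [sent, hu]

lemma sent_of_output_eq_none {c : Config V P} {u : V} {q : P.State} (hu : c u = some q)
    (hq : P.output q = none) (v : V) : sent P ident c u v = P.send q (ident v) := by
  simp [sent, hu, hq]

lemma sent_of_output_ne_none {c : Config V P} {u : V} {q : P.State} (hu : c u = some q)
    (hq : P.output q ≠ none) (v : V) : sent P ident c u v = none := by
  obtain ⟨o, ho⟩ := Option.ne_none_iff_exists'.1 hq
  simp [sent, hu, ho]

lemma mem_inbox_iff {G : SimpleGraph V} (hinj : Function.Injective ident)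
    {y : Traffic V b} {u v : V} (huv : G.Adj u v) {w : Msg b} :
    (ident u, w) ∈ inbox G ident y v ↔ y u v = some w := by
  constructor
  · rintro ⟨u', -, h, h'⟩
    rwa [hinj h]
  · exact fun h => ⟨u, huv, rfl, h⟩

end Model

namespace Execution

section Protocol

variable {V : Type*} [Fintype V] {b : ℕ} {P : Protocol b} {G : SimpleGraph V} {ident : V → ℕ}
  {s : V} {m₀ : List Bool} {e : Sym2 V} (X : Execution P G ident s m₀ e)

/-- The round in which `v` is woken up. -/
noncomputable def wake (v : V) : ℕ := sInf {t | X.cfg (t + 1) v ≠ none}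

/-- The messages received by `v` from its wake-up on. -/
def stream (v : V) (n : ℕ) : Set (ℕ × Msg b) := inbox G ident (X.traffic (X.wake v + n)) v

/-- The state of `v` after `n` rounds from its wake-up on, if it has not halted. -/
noncomputable def localState (v : V) : ℕ → P.State
  | 0 => P.init (localInput G ident s m₀ v)
  | n + 1 => P.recv (localState v n) (X.stream v n)

lemma wake_le {v : V} {t : ℕ} (h : X.cfg (t + 1) v ≠ none) : X.wake v ≤ t := Nat.sInf_le h

lemma cfg_wake_succ_ne_none_of {v : V} {t : ℕ} (h : X.cfg (t + 1) v ≠ none) :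
    X.cfg (X.wake v + 1) v ≠ none :=
  Nat.sInf_mem (s := {t | X.cfg (t + 1) v ≠ none}) ⟨t, h⟩

lemma cfg_one_source_ne_none : X.cfg 1 s ≠ none := by
  rw [X.cfg_succ 0 s]
  exact nextState_ne_none (.inl (by simp [X.cfg_zero_source]))

lemma wake_source : X.wake s = 0 := Nat.le_zero.1 (X.wake_le X.cfg_one_source_ne_none)

lemma cfg_eq_none {v : V} (hv : v ≠ s) {t : ℕ} (ht : t ≤ X.wake v) : X.cfg t v = none := by
  cases t with
  | zero => exact X.cfg_zero_of_ne v hv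
  | succ t => exact not_not.1 (Nat.notMem_of_lt_sInf (s := {t | X.cfg (t + 1) v ≠ none}) ht)

lemma cfg_wake_succ {v : V} (hw : X.cfg (X.wake v + 1) v ≠ none)
    (h : P.output (X.localState v 0) = none) :
    X.cfg (X.wake v + 1) v = some (X.localState v 1) := by
  by_cases hv : v = s
  · subst hv
    change P.output (P.init (localInput G ident v m₀ v)) = none at h
    rw [X.cfg_succ, X.wake_source, X.cfg_zero_source, nextState_of_output_eq_none h]
    simp only [localState, stream, X.wake_source]
  · rw [X.cfg_succ, X.cfg_eq_none hv le_rfl] at hw ⊢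
    simp only [nextState] at hw ⊢
    split_ifs at hw ⊢ with hI
    · exact absurd rfl hw
    · rfl

lemma cfg_wake_add {v : V} (hw : X.cfg (X.wake v + 1) v ≠ none) {n : ℕ} (hn : 0 < n)
    (h : ∀ n' < n, P.output (X.localState v n') = none) :
    X.cfg (X.wake v + n) v = some (X.localState v n) := by
  induction n, hn using Nat.le_induction with
  | base => exact X.cfg_wake_succ hw (h 0 one_pos)
  | succ n _ ih =>
    rw [← Nat.add_assoc, X.cfg_succ, ih fun n' hn' => h n' (by omega),
      nextState_of_output_eq_none (h n (by omega)), localState]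
    rfl

lemma cfg_add_of_output_eq_some {v : V} {t : ℕ} {q : P.State} {o : List Bool × ℕ}
    (h : X.cfg t v = some q) (ho : P.output q = some o) (r : ℕ) : X.cfg (t + r) v = some q := by
  induction r with
  | zero => exact h
  | succ r ih => rw [← Nat.add_assoc, X.cfg_succ, ih, nextState_of_output_eq_some ho]

lemma mem_stream_iff (hinj : Function.Injective ident) {u v : V}
    (huv : (G.deleteEdges {e}).Adj u v) {n : ℕ} {w : Msg b} : (ident u, w) ∈ X.stream v n ↔
      sent P ident (X.cfg (X.wake v + n)) u v = some w := by
  obtain ⟨hadj, hne⟩ := (SimpleGraph.deleteEdges_adj ..).1 huv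
  rw [stream, mem_inbox_iff hinj hadj, X.traffic_eq_sent _ _ _ hne]

lemma cfg_ne_none_of_sent_ne_none {u v : V} (huv : (G.deleteEdges {e}).Adj u v) {t : ℕ}
    (h : sent P ident (X.cfg t) u v ≠ none) : X.cfg (t + 1) v ≠ none := by
  obtain ⟨hadj, hne⟩ := (SimpleGraph.deleteEdges_adj ..).1 huv
  obtain ⟨x, hx⟩ := Option.ne_none_iff_exists'.1 h
  rw [X.cfg_succ]
  exact nextState_ne_none (.inr ⟨(ident u, x), u, hadj, rfl, by
    rw [X.traffic_eq_sent _ _ _ hne, hx]⟩)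

end Protocol

section Scheme

variable {V E : Type*} [Fintype V] [Fintype E] {b : ℕ} {C : Scheme E b} {G : SimpleGraph V}
  {ident : V → ℕ} {s : V} {m₀ : List Bool} {e : Sym2 V}
  (X : Execution C.protocol G ident s m₀ e)

/-- The channels before `p` in which `v` has accepted. -/
noncomputable def acc (v : V) (p : ℕ) : Set ℕ :=
  C.accepted (localInput G ident s m₀ v) (X.stream v) p

/-- The cut set of `v` after `i` iterations of channel `p`. -/
noncomputable def cut (v : V) (p i : ℕ) : Finset E :=
  C.cut (localInput G ident s m₀ v) (X.stream v) p i

/-- The symbol that `v` sends at local time `n`, if it has not halted. -/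
noncomputable def symbol (v : V) (n : ℕ) : Option (Option E) :=
  C.symbol (localInput G ident s m₀ v) (X.stream v) n

/-- The sources of channel `p`. -/
def sources (p : ℕ) : Set V := {v | C.src (localInput G ident s m₀ v) p (X.acc v p)}

/-- No node halts before the end of channel `p`. -/
def Quiet (p : ℕ) : Prop := ∀ v, ∀ p' ≤ p, C.res p' (X.acc v p') = none

lemma mem_acc_iff {v : V} {p r : ℕ} : r ∈ X.acc v p ↔ r < p ∧ X.cut v r (C.len r) = ∅ :=
  C.mem_accepted_iff

lemma localState_eq (v : V) (n : ℕ) : X.localState v n = (⟨localInput G ident s m₀ v, n,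
    fun t => if t < n then X.stream v t else ∅⟩ : NodeState b) := by
  induction n with
  | zero => simp [localState, Scheme.protocol]
  | succ n ih =>
    rw [localState, ih]
    simp only [Scheme.protocol, NodeState.mk.injEq, true_and]
    ext1 t
    rcases lt_trichotomy t n with h | rfl | h
    · simp [h, h.ne, h.trans n.lt_succ_self]
    · simp
    · simp [h.ne', h.not_gt, Nat.not_lt.2 h]

lemma output_localState (v : V) (n : ℕ) :
    C.protocol.output (X.localState v n) = C.res (C.chan n) (X.acc v (C.chan n)) := by
  rw [localState_eq, acc]
  exact congrArg _ <| C.accepted_congr fun t ht => if_pos (ht.trans_le (C.startTime_chan_le n))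

lemma send_localState (v : V) (n y : ℕ) :
    C.protocol.send (X.localState v n) y = some (C.enc (X.symbol v n)) := by
  rw [localState_eq, symbol]
  exact congrArg (some ∘ C.enc) (C.symbol_congr fun t ht => if_pos ht)

variable {X} in
lemma Quiet.output_eq_none {p : ℕ} (hq : X.Quiet p) (v : V) {n : ℕ}
    (hn : n < C.startTime (p + 1)) : C.protocol.output (X.localState v n) = none := by
  rw [output_localState]
  exact hq v _ (Nat.lt_succ_iff.1 (C.startTime_strictMono.lt_iff_lt.1
    ((C.startTime_chan_le n).trans_lt hn)))

lemma quiet_zero : X.Quiet 0 := fun v p hp => by rw [Nat.le_zero.1 hp, C.res_zero]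

lemma cfg_ne_none_of_adj {u v : V} (hw : X.cfg (X.wake u + 1) u ≠ none)
    (huv : (G.deleteEdges {e}).Adj u v) : X.cfg (X.wake u + 2) v ≠ none := by
  have hstart : 0 + 1 < C.startTime (0 + 1) :=
    (Nat.add_le_add_right (Nat.zero_le _) 1).trans_lt
      (C.iterStart_add_lt (C.len_pos 0) (by simp [Scheme.width] : 1 < C.width 0))
  have hout : ∀ n < 2, C.protocol.output (X.localState u n) = none := fun n hn =>
    X.quiet_zero.output_eq_none u (by omega)
  refine X.cfg_ne_none_of_sent_ne_none huv ?_
  rw [sent_of_output_eq_none (X.cfg_wake_add hw one_pos fun n hn => hout n (by omega))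
    (hout 1 one_lt_two), send_localState]
  exact Option.some_ne_none _

lemma cfg_wake_succ_ne_none_of_walk {u v : V} (w : (G.deleteEdges {e}).Walk u v)
    (hu : X.cfg (X.wake u + 1) u ≠ none) :
    X.cfg (X.wake v + 1) v ≠ none ∧ X.wake v ≤ X.wake u + w.length := by
  induction w with
  | nil => exact ⟨hu, le_rfl⟩
  | cons h w ih =>
    have hz := X.cfg_ne_none_of_adj hu h
    obtain ⟨hne, hle⟩ := ih (X.cfg_wake_succ_ne_none_of hz)
    have := X.wake_le hz
    exact ⟨hne, by rw [SimpleGraph.Walk.length_cons]; omega⟩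

section Connected

variable (hG : (G.deleteEdges {e}).Connected)
include hG

lemma cfg_wake_succ_ne_none (v : V) : X.cfg (X.wake v + 1) v ≠ none := by
  obtain ⟨w⟩ := hG.preconnected s v
  exact (X.cfg_wake_succ_ne_none_of_walk w
    (X.cfg_wake_succ_ne_none_of X.cfg_one_source_ne_none)).1

lemma wake_le_dist (v : V) : X.wake v ≤ (G.deleteEdges {e}).dist s v := by
  obtain ⟨w, hw⟩ := hG.exists_walk_length_eq_dist s v
  have := (X.cfg_wake_succ_ne_none_of_walk w
    (X.cfg_wake_succ_ne_none_of X.cfg_one_source_ne_none)).2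
  rwa [X.wake_source, hw, Nat.zero_add] at this

lemma wake_le_succ_of_adj {u v : V} (huv : (G.deleteEdges {e}).Adj u v) :
    X.wake v ≤ X.wake u + 1 :=
  X.wake_le (X.cfg_ne_none_of_adj (X.cfg_wake_succ_ne_none hG u) huv)

variable {p : ℕ} (hq : X.Quiet p)
include hq

lemma sent_wake_add (u v : V) {n : ℕ} (hn : 0 < n) (hn' : n < C.startTime (p + 1)) :
    sent C.protocol ident (X.cfg (X.wake u + n)) u v = some (C.enc (X.symbol u n)) := by
  rw [sent_of_output_eq_none (X.cfg_wake_add (X.cfg_wake_succ_ne_none hG u) hn fun n' h =>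
    hq.output_eq_none u (h.trans hn')) (hq.output_eq_none u hn'), send_localState]

lemma exists_symbol_eq_of_sent_eq (henc : Function.Injective C.enc) {u v : V} {t : ℕ}
    {x : Option E} (ht : t ≤ X.wake u + C.startTime (p + 1))
    (h : sent C.protocol ident (X.cfg t) u v = some (C.enc (some x))) :
    ∃ n, t = X.wake u + n ∧ X.symbol u n = some x := by
  suffices ∃ n, t = X.wake u + n ∧ X.cfg t u = some (X.localState u n) by
    obtain ⟨n, rfl, hn⟩ := this
    have hout : C.protocol.output (X.localState u n) = none := by
      by_contra hout
      simp [sent_of_output_ne_none hn hout] at h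
    rw [sent_of_output_eq_none hn hout, send_localState] at h
    exact ⟨n, rfl, henc (Option.some.inj h)⟩
  rcases lt_or_ge (X.wake u) t with htu | htu
  · obtain ⟨n, rfl⟩ := Nat.exists_eq_add_of_le htu.le
    exact ⟨n, rfl, X.cfg_wake_add (X.cfg_wake_succ_ne_none hG u) (by omega) fun n' h =>
      hq.output_eq_none u (by omega)⟩
  · by_cases hu : u = s
    · subst hu
      rw [X.wake_source] at htu
      obtain rfl := Nat.le_zero.1 htu
      exact ⟨0, X.wake_source.symm, X.cfg_zero_source⟩
    · simp [sent_of_eq_none (X.cfg_eq_none hu htu)] at h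

lemma mem_heard_iff (hident : Function.Injective ident) (henc : Function.Injective C.enc)
    {u v : V} (huv : (G.deleteEdges {e}).Adj u v) {i : ℕ} (hi : i < C.len p) {x : Option E} :
    (ident u, x) ∈ C.heard (X.stream v) p i ↔
      (X.cut u p i).card ≤ i ∧ ∃ j ≤ C.len p, (X.cut u p i).toList[j]? = x := by
  have huv' := X.wake_le_succ_of_adj hG huv
  have hvu' := X.wake_le_succ_of_adj hG huv.symm
  constructor
  · rintro ⟨c, hc, hmem⟩
    have hlt := C.iterStart_add_lt hi hc
    obtain ⟨n, hn, hsymb⟩ := X.exists_symbol_eq_of_sent_eq hG hq henc (by omega)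
      ((X.mem_stream_iff hident huv).1 hmem)
    obtain ⟨p', i', j, hi', hj, rfl, hcard, hx⟩ := C.exists_of_symbol_eq_some hsymb
    obtain ⟨c', hc', heq⟩ : ∃ c' < C.width p', C.iterStart p i + c = C.iterStart p' i' + c' :=
      ⟨j + 1 + X.wake u - X.wake v, by rw [Scheme.width]; omega, by omega⟩
    obtain ⟨hp, hi, -⟩ := C.clock_eq hi hc
    obtain ⟨hp', hi', -⟩ := C.clock_eq hi' hc'
    obtain rfl : p = p' := by rw [← hp, ← hp', heq]
    obtain rfl : i = i' := by rw [← hi, ← hi', heq]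
    exact ⟨hcard, j, hj, hx⟩
  · rintro ⟨hcard, j, hj, rfl⟩
    have hwidth : j + 1 < C.width p := by rw [Scheme.width]; omega
    refine ⟨j + 1 + X.wake u - X.wake v, by rw [Scheme.width]; omega, ?_⟩
    rw [X.mem_stream_iff hident huv, show X.wake v + (C.iterStart p i +
      (j + 1 + X.wake u - X.wake v)) = X.wake u + (C.iterStart p i + (j + 1)) by omega,
      X.sent_wake_add hG hq u v (by omega) (C.iterStart_add_lt hi hwidth), symbol,
      C.symbol_iterStart_add hi hwidth, if_pos ⟨hcard, by omega, by omega⟩]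
    rfl

lemma isFlood (hident : Function.Injective ident) (henc : Function.Injective C.enc) :
    IsFlood G e ident C.edge (X.sources p) (C.len p) (fun v => X.cut v p)
      fun v => C.heard (X.stream v) p where
  cut_zero_of_mem _ hv := if_pos hv
  cut_zero_of_notMem _ hv := if_neg hv
  cut_succ _ _ := rfl
  exists_adj := by
    rintro v i a ⟨c, -, u, huv, ha, -⟩
    exact ⟨u, huv, ha⟩
  none_mem_heard u v i huv hi := by
    rw [X.mem_heard_iff hG hq hident henc huv hi]
    refine and_iff_left_of_imp fun hcard => ⟨_, hcard.trans hi.le, ?_⟩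
    rw [List.getElem?_eq_none_iff, Finset.length_toList]
  some_mem_heard u v i f huv hi hcard := by
    rw [X.mem_heard_iff hG hq hident henc huv hi, ← Finset.mem_toList, List.mem_iff_getElem?]
    refine ⟨fun ⟨_, j, _, hj⟩ => ⟨j, hj⟩, fun ⟨j, hj⟩ => ⟨hcard, j, ?_, hj⟩⟩
    have := (List.getElem?_eq_some_iff.1 hj).1
    rw [Finset.length_toList] at this
    omega

lemma exists_cfg_eq_of_res_eq_some {v : V} {o : List Bool × ℕ}
    (h : C.res (p + 1) (X.acc v (p + 1)) = some o) {t : ℕ}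
    (ht : X.wake v + C.startTime (p + 1) ≤ t) :
    ∃ q, X.cfg t v = some q ∧ C.protocol.output q = some o := by
  have hchan : C.chan (C.startTime (p + 1)) = p + 1 :=
    C.chan_eq le_rfl (C.startTime_strictMono (p + 1).lt_succ_self)
  have hout : C.protocol.output (X.localState v (C.startTime (p + 1))) = some o := by
    rw [output_localState, hchan, h]
  have hcfg := X.cfg_wake_add (X.cfg_wake_succ_ne_none hG v)
    (Nat.zero_le _ |>.trans_lt (C.startTime_strictMono p.lt_succ_self))
    fun n hn => hq.output_eq_none v hn
  obtain ⟨r, rfl⟩ := Nat.exists_eq_add_of_le ht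
  exact ⟨_, X.cfg_add_of_output_eq_some hcfg hout r, hout⟩

end Connected

end Scheme

end Execution

/-- The facts that describe a message: fact `0` always holds, and fact `2 * r + x + 1` says that bit
number `r` exists and equals `x`. -/
def BitFact (m : List Bool) : ℕ → Prop
  | 0 => True
  | c + 1 => m[c.div2]? = some c.bodd

lemma eq_of_bitFact_iff {L : ℕ} {m m' : List Bool} (hm : m.length ≤ L) (hm' : m'.length ≤ L)
    (h : ∀ c < 2 * L + 1, (BitFact m c ↔ BitFact m' c)) : m = m' := by
  refine List.ext_getElem? fun r => ?_
  rcases lt_or_ge r L with hr | hr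
  · refine Option.ext fun x => ?_
    have hlt : Nat.bit x r + 1 < 2 * L + 1 := by
      have := x.toNat_le
      rw [Nat.bit_val]
      omega
    simpa only [BitFact, Nat.div2_bit, Nat.bodd_bit] using h _ hlt
  · rw [List.getElem?_eq_none (hm.trans hr), List.getElem?_eq_none (hm'.trans hr)]

/-- The number of channels of a phase of the broadcast of a message of length at most `L`: the
flood, the alarm, and one channel for each of the `2 * L + 1` facts. -/
def phaseLen (L : ℕ) : ℕ := 2 * L + 3

/-- A node that has accepted in the channels `acc` and is about to enter channel `p` knows the
output `o`: a phase has just ended, in which it has accepted exactly the facts that describe the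
message. -/
def Decides (L p : ℕ) (acc : Set ℕ) (o : List Bool × ℕ) : Prop :=
  o.1.length ≤ L ∧ ∃ j, p = (j + 1) * phaseLen L ∧ o.2 = 2 * 2 ^ j ∧
    ∀ c < 2 * L + 1, (j * phaseLen L + (c + 2) ∈ acc ↔ BitFact o.1 c)

open Classical in
/-- The broadcast scheme for messages of length at most `L`. In channel `0` of phase `j` the source
floods to distance about `2 ^ j`. In channel `1`, those who have not accepted raise an alarm. Unless
the source hears the alarm, it sends fact `c` about its message in channel `c + 2`. -/
noncomputable def broadcast {E : Type*} {b : ℕ} (edge : Sym2 ℕ → E)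
    (enc : Option (Option E) → Msg b) (L : ℕ) : Scheme E b where
  edge := edge
  enc := enc
  len p := if p % phaseLen L = 0 then 2 ^ (p / phaseLen L) else 26 * 2 ^ (p / phaseLen L)
  len_pos p := by split_ifs <;> positivity
  src inp p acc := match p % phaseLen L with
    | 0 => inp.source ≠ none
    | 1 => p - 1 ∉ acc
    | c + 2 => p - (c + 1) ∉ acc ∧ ∃ m, inp.source = some m ∧ BitFact m c
  res p acc := if h : ∃ o, Decides L p acc o then some h.choose else none
  res_zero acc := dif_neg fun ⟨_, _, _, h, _⟩ =>
    (Nat.mul_pos (Nat.succ_pos _) (Nat.succ_pos _)).ne h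

section Broadcast

variable {E : Type*} {b : ℕ} {edge : Sym2 ℕ → E} {enc : Option (Option E) → Msg b} {L : ℕ}

lemma phaseLen_pos : 0 < phaseLen L := Nat.succ_pos _

lemma add_two_lt_phaseLen {c : ℕ} (hc : c < 2 * L + 1) : c + 2 < phaseLen L :=
  Nat.add_lt_add_right hc 2

lemma phase_mod {j r : ℕ} (hr : r < phaseLen L) : (j * phaseLen L + r) % phaseLen L = r := by
  rw [Nat.mul_add_mod_self_right, Nat.mod_eq_of_lt hr]

lemma phase_div {j r : ℕ} (hr : r < phaseLen L) : (j * phaseLen L + r) / phaseLen L = j := by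
  rw [Nat.add_comm, Nat.add_mul_div_right _ _ phaseLen_pos, Nat.div_eq_of_lt hr, Nat.zero_add]

lemma Decides.eq {p : ℕ} {acc : Set ℕ} {o o' : List Bool × ℕ} (h : Decides L p acc o)
    (h' : Decides L p acc o') : o = o' := by
  obtain ⟨hl, j, rfl, hd, hc⟩ := h
  obtain ⟨hl', j', hj, hd', hc'⟩ := h'
  obtain rfl : j = j' := Nat.succ_injective (Nat.eq_of_mul_eq_mul_right phaseLen_pos hj)
  exact Prod.ext (eq_of_bitFact_iff hl hl' fun c hlt => (hc c hlt).symm.trans (hc' c hlt))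
    (hd.trans hd'.symm)

lemma broadcast_res_of_decides {p : ℕ} {acc : Set ℕ} {o : List Bool × ℕ} (h : Decides L p acc o) :
    (broadcast edge enc L).res p acc = some o := by
  have hex : ∃ o, Decides L p acc o := ⟨o, h⟩
  exact (dif_pos hex).trans (congrArg some (hex.choose_spec.eq h))

lemma broadcast_res_of_mod_ne {p : ℕ} (hp : p % phaseLen L ≠ 0) (acc : Set ℕ) :
    (broadcast edge enc L).res p acc = none := by
  refine dif_neg ?_
  rintro ⟨o, -, j, rfl, -⟩
  exact hp (Nat.mul_mod_left _ _)

lemma broadcast_res_of_notMem {j : ℕ} {acc : Set ℕ} (h : j * phaseLen L + 2 ∉ acc) :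
    (broadcast edge enc L).res ((j + 1) * phaseLen L) acc = none := by
  refine dif_neg ?_
  rintro ⟨o, -, j', hj, -, hc⟩
  obtain rfl : j = j' := Nat.succ_injective (Nat.eq_of_mul_eq_mul_right phaseLen_pos hj)
  exact h ((hc 0 (Nat.succ_pos _)).2 trivial)

lemma broadcast_len_zero (j : ℕ) : (broadcast edge enc L).len (j * phaseLen L) = 2 ^ j :=
  (if_pos (Nat.mul_mod_left _ _)).trans (by rw [Nat.mul_div_cancel _ phaseLen_pos])

lemma broadcast_len_of_pos {j r : ℕ} (hr : r < phaseLen L) (h : 0 < r) :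
    (broadcast edge enc L).len (j * phaseLen L + r) = 26 * 2 ^ j := by
  simp only [broadcast, phase_mod hr, phase_div hr, h.ne', if_false]

lemma broadcast_len_le {j r : ℕ} (hr : r < phaseLen L) :
    (broadcast edge enc L).len (j * phaseLen L + r) ≤ 26 * 2 ^ j := by
  rcases Nat.eq_zero_or_pos r with rfl | h
  · rw [Nat.add_zero, broadcast_len_zero]
    omega
  · exact (broadcast_len_of_pos hr h).le

lemma broadcast_startTime_le (j : ℕ) :
    (broadcast edge enc L).startTime (j * phaseLen L) ≤ phaseLen L * (26 * 29 * 4 ^ j) := by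
  induction j with
  | zero => simp [Scheme.startTime]
  | succ j ih =>
    have hone : 1 ≤ 2 ^ j := Nat.one_le_two_pow
    have hfour : 4 ^ j = 2 ^ j * 2 ^ j := by rw [← mul_pow]; rfl
    rw [Nat.succ_mul]
    calc (broadcast edge enc L).startTime (j * phaseLen L + phaseLen L)
        ≤ (broadcast edge enc L).startTime (j * phaseLen L) +
            phaseLen L * (26 * 2 ^ j * (26 * 2 ^ j + 3)) :=
          Scheme.startTime_add_le _ fun r hr => broadcast_len_le hr
      _ ≤ phaseLen L * (26 * 29 * 4 ^ j) + phaseLen L * (26 * 29 * 4 ^ j) := by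
          refine Nat.add_le_add ih (Nat.mul_le_mul_left _ ?_)
          rw [hfour]
          nlinarith
      _ ≤ phaseLen L * (26 * 29 * 4 ^ (j + 1)) := by
          rw [pow_succ]
          nlinarith [Nat.zero_le (phaseLen L * 4 ^ j)]

end Broadcast

namespace Execution

section Broadcast

variable {V E : Type*} [Fintype V] [Fintype E] {b : ℕ} {edge : Sym2 ℕ → E}
  {enc : Option (Option E) → Msg b} {L : ℕ} {G : SimpleGraph V} {ident : V → ℕ} {s : V}
  {m₀ : List Bool} {e : Sym2 V} (X : Execution (broadcast edge enc L).protocol G ident s m₀ e)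

/-- The source hears no alarm in phase `j`. -/
def Passes (j : ℕ) : Prop :=
  X.cut s (j * phaseLen L + 1) ((broadcast edge enc L).len (j * phaseLen L + 1)) ≠ ∅

lemma sources_flood (j : ℕ) : X.sources (j * phaseLen L) = {s} := by
  ext v
  by_cases hv : v = s <;> simp [sources, broadcast, localInput, hv]

lemma mem_sources_alarm {j : ℕ} {v : V} : v ∈ X.sources (j * phaseLen L + 1) ↔
    X.cut v (j * phaseLen L) ((broadcast edge enc L).len (j * phaseLen L)) ≠ ∅ := by
  have hmod : (j * phaseLen L + 1) % phaseLen L = 1 := phase_mod (by simp [phaseLen])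
  have hmem := X.mem_acc_iff (v := v) (p := j * phaseLen L + 1) (r := j * phaseLen L)
  rw [and_iff_right (Nat.lt_succ_self _)] at hmem
  rw [Ne, ← hmem]
  simp [sources, broadcast, hmod]

lemma mem_sources_fact {j c : ℕ} (hc : c < 2 * L + 1) {v : V} :
    v ∈ X.sources (j * phaseLen L + (c + 2)) ↔ v = s ∧ X.Passes j ∧ BitFact m₀ c := by
  have hmod : (j * phaseLen L + (c + 2)) % phaseLen L = c + 2 := phase_mod (add_two_lt_phaseLen hc)
  have hsub : j * phaseLen L + (c + 2) - (c + 1) = j * phaseLen L + 1 := by omega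
  have hmem := X.mem_acc_iff (v := v) (p := j * phaseLen L + (c + 2)) (r := j * phaseLen L + 1)
  rw [and_iff_right (by omega)] at hmem
  by_cases hv : v = s
  · subst hv
    rw [Passes, Ne, ← hmem]
    simp [sources, broadcast, hmod, hsub, localInput]
  · simp [sources, broadcast, hmod, localInput, hv]

lemma Quiet.add_of_lt {X : Execution (broadcast edge enc L).protocol G ident s m₀ e} {j : ℕ}
    (hq : X.Quiet (j * phaseLen L)) {r : ℕ} (hr : r < phaseLen L) :
    X.Quiet (j * phaseLen L + r) := by
  intro v p' hp'
  rcases le_or_gt p' (j * phaseLen L) with h | h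
  · exact hq v p' h
  · obtain ⟨r', rfl⟩ := Nat.exists_eq_add_of_le h.le
    apply broadcast_res_of_mod_ne
    rw [phase_mod (by omega)]
    omega

variable (hident : Function.Injective ident) (henc : Function.Injective enc)
include hident henc

section Connected

variable (hG : (G.deleteEdges {e}).Connected)
include hG

lemma quiet_of_not_passes {j : ℕ} (hq : X.Quiet (j * phaseLen L)) (hj : ¬X.Passes j) :
    X.Quiet ((j + 1) * phaseLen L) := by
  intro v p' hp'
  rcases hp'.lt_or_eq with h | rfl
  · have hlast : phaseLen L - 1 < phaseLen L := Nat.sub_lt phaseLen_pos one_pos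
    exact hq.add_of_lt hlast v p' (by rw [Nat.succ_mul] at h; omega)
  · refine broadcast_res_of_notMem fun hmem => ?_
    have hq' := hq.add_of_lt (r := 0 + 2) (by simp [phaseLen])
    obtain ⟨u, hu, -⟩ := (X.isFlood hG hq' hident henc).exists_dist_le_of_cut_eq_empty hG
      (X.mem_acc_iff.1 hmem).2
    exact hj ((X.mem_sources_fact (Nat.succ_pos _)).1 hu).2.1

lemma quiet_of_forall_not_passes {j : ℕ} (h : ∀ i < j, ¬X.Passes i) :
    X.Quiet (j * phaseLen L) := by
  induction j with
  | zero => simpa only [Nat.zero_mul] using X.quiet_zero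
  | succ j ih =>
    exact X.quiet_of_not_passes hident henc hG (ih fun i hi => h i (hi.trans j.lt_succ_self))
      (h j j.lt_succ_self)

lemma dist_le_of_notMem_sources_alarm {j : ℕ} (hq : X.Quiet (j * phaseLen L)) {v : V}
    (hv : v ∉ X.sources (j * phaseLen L + 1)) : (G.deleteEdges {e}).dist s v ≤ 2 ^ j := by
  rw [mem_sources_alarm, not_not] at hv
  obtain ⟨u, hu, hdist⟩ := (X.isFlood hG hq hident henc).exists_dist_le_of_cut_eq_empty hG hv
  rw [sources_flood] at hu
  rwa [Set.mem_singleton_iff.1 hu, broadcast_len_zero] at hdist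

end Connected

variable (hedge : Function.Injective fun f : Sym2 V => edge (f.map ident)) [Nontrivial V]
  (hG : G.IsEdgeConnected 3)
include hedge hG

lemma passes_of_diam_le {j : ℕ} (hq : X.Quiet (j * phaseLen L)) (hj : 13 * G.diam ≤ 2 ^ j) :
    X.Passes j := by
  have hG' := connected_deleteEdges_singleton hG e
  intro hcut
  have hq' := hq.add_of_lt (r := 1) (by simp [phaseLen])
  obtain ⟨v, hv, -⟩ := (X.isFlood hG' hq' hident henc).exists_dist_le_of_cut_eq_empty hG' hcut
  refine X.mem_sources_alarm.1 hv <| (X.isFlood hG' hq hident henc).cut_eq_empty hedge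
    (connected_deleteEdges_pair hG e) fun f => ⟨s, by rw [sources_flood]; rfl, ?_⟩
  rw [broadcast_len_zero]
  exact (dist_deleteEdges_pair_le hG e f s v).trans hj

lemma diam_le_of_passes {j : ℕ} (hq : X.Quiet (j * phaseLen L)) (hj : X.Passes j) :
    G.diam ≤ 2 * 2 ^ j := by
  have hG' := connected_deleteEdges_singleton hG e
  have hone : 1 ≤ 2 ^ j := Nat.one_le_two_pow
  have hlt : 1 < phaseLen L := by simp [phaseLen]
  obtain ⟨f, hf⟩ : ∃ f, ∀ u ∈ X.sources (j * phaseLen L + 1),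
      26 * 2 ^ j < ((G.deleteEdges {e}).deleteEdges {f}).dist u s := by
    by_contra! h
    refine hj ((X.isFlood hG' (hq.add_of_lt hlt) hident henc).cut_eq_empty hedge
      (connected_deleteEdges_pair hG e) ?_)
    rwa [broadcast_len_of_pos hlt one_pos]
  have hball : ∀ v, (G.deleteEdges {e}).dist s v ≤ 2 ^ j :=
    dist_le_of_dist_deleteEdges_le (connected_deleteEdges_pair hG e f) fun x hx =>
      X.dist_le_of_notMem_sources_alarm hident henc hG' hq fun hmem => by
        have := hf x hmem
        rw [SimpleGraph.dist_comm] at this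
        omega
  exact diam_le_two_mul (hG.connected three_ne_zero) fun v =>
    ((hG' s v).dist_anti (SimpleGraph.deleteEdges_le _)).trans (hball v)

lemma decides_of_passes (hm : m₀.length ≤ L) {j : ℕ} (hq : X.Quiet (j * phaseLen L))
    (hj : X.Passes j) (v : V) : Decides L ((j + 1) * phaseLen L)
      (X.acc v ((j + 1) * phaseLen L)) (m₀, 2 * 2 ^ j) := by
  have hG' := connected_deleteEdges_singleton hG e
  refine ⟨hm, j, rfl, rfl, fun c hc => ?_⟩
  have hlt := add_two_lt_phaseLen hc
  have hflood := X.isFlood hG' (hq.add_of_lt hlt) hident henc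
  rw [X.mem_acc_iff, Nat.succ_mul, and_iff_right (Nat.add_lt_add_left hlt _)]
  constructor
  · intro hcut
    obtain ⟨u, hu, -⟩ := hflood.exists_dist_le_of_cut_eq_empty hG' hcut
    exact ((X.mem_sources_fact hc).1 hu).2.2
  · intro hfact
    refine hflood.cut_eq_empty hedge (connected_deleteEdges_pair hG e) fun f =>
      ⟨s, (X.mem_sources_fact hc).2 ⟨rfl, hj, hfact⟩, ?_⟩
    have := dist_deleteEdges_pair_le hG e f s v
    have := X.diam_le_of_passes hident henc hedge hG hq hj
    rw [broadcast_len_of_pos hlt (Nat.succ_pos _)]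
    omega

lemma exists_passes : ∃ j, X.Quiet (j * phaseLen L) ∧ X.Passes j ∧ 2 ^ j ≤ 26 * G.diam := by
  have hG' := connected_deleteEdges_singleton hG e
  have hD : 0 < G.diam := Nat.pos_of_ne_zero
    (SimpleGraph.connected_iff_diam_ne_zero.1 (hG.connected three_ne_zero))
  obtain ⟨J, hJ, hJ'⟩ : ∃ J, 13 * G.diam ≤ 2 ^ J ∧ 2 ^ J ≤ 26 * G.diam := by
    refine ⟨Nat.log 2 (26 * G.diam), ?_, Nat.pow_log_le_self 2 (by omega)⟩
    have := Nat.lt_pow_succ_log_self one_lt_two (26 * G.diam)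
    rw [pow_succ] at this
    omega
  have hex : ∃ j ≤ J, X.Passes j := by
    by_contra! h
    exact h J le_rfl (X.passes_of_diam_le hident henc hedge hG
      (X.quiet_of_forall_not_passes hident henc hG' fun i hi => h i hi.le) hJ)
  classical
  obtain ⟨hle, hpass⟩ := Nat.find_spec hex
  have hquiet := X.quiet_of_forall_not_passes hident henc hG' fun i hi hi' =>
    Nat.find_min hex hi ⟨hi.le.trans hle, hi'⟩
  exact ⟨_, hquiet, hpass, (Nat.pow_le_pow_right two_pos hle).trans hJ'⟩

lemma exists_cfg_eq_of_le (hm : m₀.length ≤ L) (v : V) {t : ℕ}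
    (ht : (13 + phaseLen L * (26 * 29 * 4 * 26 ^ 2)) * G.diam ^ 2 ≤ t) :
    ∃ d q, X.cfg t v = some q ∧ (broadcast edge enc L).protocol.output q = some (m₀, d) ∧
      G.diam ≤ d ∧ d ≤ 52 * G.diam := by
  have hG' := connected_deleteEdges_singleton hG e
  obtain ⟨j, hq, hp, hj⟩ := X.exists_passes hident henc hedge hG
  have hwake : X.wake v ≤ 13 * G.diam := by
    simpa using (X.wake_le_dist hG' v).trans (by simpa using dist_deleteEdges_pair_le hG e e s v)
  have htime : X.wake v + (broadcast edge enc L).startTime ((j + 1) * phaseLen L) ≤ t :=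
    calc X.wake v + (broadcast edge enc L).startTime ((j + 1) * phaseLen L)
        ≤ 13 * G.diam + phaseLen L * (26 * 29 * 4 ^ (j + 1)) :=
          Nat.add_le_add hwake (broadcast_startTime_le _)
      _ = 13 * G.diam + phaseLen L * (26 * 29 * 4 * (2 ^ j) ^ 2) := by
          rw [pow_succ, ← pow_mul, Nat.mul_comm j, pow_mul]
          ring
      _ ≤ 13 * G.diam ^ 2 + phaseLen L * (26 * 29 * 4 * (26 * G.diam) ^ 2) := by
          gcongr
          exact Nat.le_self_pow two_ne_zero _
      _ = (13 + phaseLen L * (26 * 29 * 4 * 26 ^ 2)) * G.diam ^ 2 := by ring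
      _ ≤ t := ht
  have hres := broadcast_res_of_decides (edge := edge) (enc := enc)
    (X.decides_of_passes hident henc hedge hG hm hq hp v)
  have hlast : (j + 1) * phaseLen L = j * phaseLen L + (phaseLen L - 1) + 1 := by
    rw [Nat.succ_mul, Nat.add_assoc, Nat.sub_add_cancel phaseLen_pos]
  rw [hlast] at hres htime
  obtain ⟨q, hcfg, hout⟩ := X.exists_cfg_eq_of_res_eq_some hG'
    (hq.add_of_lt (Nat.sub_lt phaseLen_pos one_pos)) hres htime
  exact ⟨_, q, hcfg, hout, X.diam_le_of_passes hident henc hedge hG hq hp, by omega⟩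

end Broadcast

end Execution

/-- The execution given by `run`. -/
noncomputable def runExecution {V : Type*} [Fintype V] {b : ℕ} (P : Protocol b) (G : SimpleGraph V)
    (ident : V → ℕ) (s : V) (m₀ : List Bool) {F : Set (Sym2 V)} (A : Adversary V b) {e : Sym2 V}
    (hF : F ⊆ {e}) : Execution P G ident s m₀ e where
  cfg t := (run G ident P s m₀ F A t).1
  traffic t :=
    let c := (run G ident P s m₀ F A t).1
    delivered F (sent P ident c) (A (sent P ident c :: (run G ident P s m₀ F A t).2))
  cfg_zero_source := if_pos rfl
  cfg_zero_of_ne _ hv := if_neg hv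
  cfg_succ _ _ := rfl
  traffic_eq_sent _ _ _ h := if_neg fun hmem => h (hF hmem)

/-- The name of an edge, given the identifiers of its ends, which are supposed to be at most `M`. -/
def edgeName (M : ℕ) (z : Sym2 ℕ) : Sym2 (Fin (M + 1)) := z.map (Fin.ofNat (M + 1))

lemma edgeName_map_injective {V : Type*} {ident : V → ℕ} (hident : Function.Injective ident)
    {M : ℕ} (hM : ∀ v, ident v ≤ M) :
    Function.Injective fun f : Sym2 V => edgeName M (f.map ident) := by
  have hinj : Function.Injective fun v => Fin.ofNat (M + 1) (ident v) := fun u v h => hident <| by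
    simpa [Fin.ofNat, Nat.mod_eq_of_lt, Nat.lt_succ_of_le, hM] using h
  intro f f' h
  simp only [edgeName, Sym2.map_map] at h
  exact Sym2.map.injective hinj h

lemma exists_injective_msg {α : Type*} [Fintype α] {b : ℕ} (h : Fintype.card α ≤ 2 ^ b) :
    ∃ enc : α → Msg b, Function.Injective enc := by
  obtain ⟨f⟩ := Function.Embedding.nonempty_of_card_le (α := α) (β := List.Vector Bool b)
    (by rwa [card_vector, Fintype.card_bool])
  exact ⟨fun x => ⟨(f x).1, (f x).2.le⟩, fun x y h => f.injective (Subtype.ext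
    (congrArg (fun w : Msg b => w.1) h))⟩

/-- An encoding of the elements of `α` by messages, injective if there is one. -/
noncomputable def msgCode (α : Type*) (b : ℕ) : α → Msg b :=
  @Classical.epsilon _ ⟨fun _ => ⟨[], Nat.zero_le b⟩⟩ Function.Injective

lemma card_option_option_sym2_le {N : ℕ} (hN : 2 ≤ N) (k : ℕ) :
    Fintype.card (Option (Option (Sym2 (Fin (N ^ k + 1))))) ≤
      2 ^ ((2 * k + 3) * Nat.clog 2 N) := by
  have hone : 1 ≤ N ^ k := Nat.one_le_pow _ _ (by omega)
  rw [Fintype.card_option, Fintype.card_option, Sym2.card, Fintype.card_fin]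
  calc (N ^ k + 1 + 1).choose 2 + 1 + 1 ≤ 2 ^ 3 * (N ^ k) ^ 2 := by
        have := Nat.choose_two_right (N ^ k + 1 + 1)
        have := Nat.div_mul_le_self ((N ^ k + 1 + 1) * (N ^ k + 1 + 1 - 1)) 2
        rw [Nat.add_sub_cancel] at *
        nlinarith
    _ ≤ N ^ 3 * (N ^ k) ^ 2 := Nat.mul_le_mul_right _ (Nat.pow_le_pow_left hN 3)
    _ = N ^ (2 * k + 3) := by ring
    _ ≤ (2 ^ Nat.clog 2 N) ^ (2 * k + 3) :=
        Nat.pow_le_pow_left (Nat.le_pow_clog one_lt_two N) _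
    _ = 2 ^ ((2 * k + 3) * Nat.clog 2 N) := by rw [← pow_mul, Nat.mul_comm]

/-- The algorithm run with the estimate `N` of the number of nodes, for identifiers at most `N ^ k`
and messages of length at most `k * clog 2 N`. -/
noncomputable def broadcastAlg (k N : ℕ) : Protocol ((2 * k + 3) * Nat.clog 2 N) :=
  (broadcast (edgeName (N ^ k)) (msgCode _ _) (k * Nat.clog 2 N)).protocol

/-- The constant in the bound on the number of rounds. -/
def roundConst (k : ℕ) : ℕ := 13 + (2 * k + 3) * (26 * 29 * 4 * 26 ^ 2)

lemma exists_subset_singleton {α : Type*} [Nonempty α] {F : Set α} (hF : F.encard ≤ 1) :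
    ∃ e, F ⊆ {e} := by
  rcases Set.encard_le_one_iff_eq.1 hF with rfl | ⟨e, rfl⟩
  · exact ⟨Classical.arbitrary α, Set.empty_subset _⟩
  · exact ⟨e, subset_rfl⟩

lemma le_roundConst_mul (k : ℕ) {c : ℕ} (hc : 1 ≤ c) :
    13 + phaseLen (k * c) * (26 * 29 * 4 * 26 ^ 2) ≤ roundConst k * c := by
  rw [roundConst, phaseLen]
  nlinarith

lemma clog_le_mul_clog {b m n k : ℕ} (hb : 1 < b) (h : m ≤ n ^ k) :
    Nat.clog b m ≤ k * Nat.clog b n :=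
  Nat.clog_le_of_le_pow <| h.trans <| by
    rw [Nat.mul_comm, pow_mul]
    exact Nat.pow_le_pow_left (Nat.le_pow_clog hb n) k

lemma roundConst_mul_clog_le {k n N : ℕ} (hN : N ≤ n ^ k) (D : ℕ) :
    roundConst k * D ^ 2 * Nat.clog 2 N ≤
      (k + 1) * roundConst k * D ^ 2 * Nat.clog 2 n ^ ((k + 1) * roundConst k) := by
  calc roundConst k * D ^ 2 * Nat.clog 2 N
      ≤ roundConst k * D ^ 2 * ((k + 1) * Nat.clog 2 n) := by
        gcongr
        exact (clog_le_mul_clog one_lt_two hN).trans (Nat.mul_le_mul_right _ k.le_succ)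
    _ = (k + 1) * roundConst k * D ^ 2 * Nat.clog 2 n := by ring
    _ ≤ (k + 1) * roundConst k * D ^ 2 * Nat.clog 2 n ^ ((k + 1) * roundConst k) := by
        gcongr
        exact Nat.le_self_pow (by simp [roundConst]) _

theorem theorem1_general {V : Type*} [Fintype V] [Nontrivial V] {G : SimpleGraph V}
    (hG : G.IsEdgeConnected 3) {ident : V → ℕ} (hident : Function.Injective ident) {k N : ℕ}
    (hN : 2 ≤ N) (hle : ∀ v, ident v ≤ N ^ k) (s : V) {m₀ : List Bool}
    (hm : m₀.length ≤ k * Nat.clog 2 N) {F : Set (Sym2 V)} (hF : F.encard ≤ 1)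
    (A : Adversary V ((2 * k + 3) * Nat.clog 2 N)) {r : ℕ}
    (hr : roundConst k * G.diam ^ 2 * Nat.clog 2 N ≤ r) (v : V) :
    ∃ d, HaltedWith G ident (broadcastAlg k N) s m₀ F A r v m₀ d ∧
      G.diam ≤ d ∧ d ≤ 52 * G.diam := by
  have : Nonempty (Sym2 V) := ⟨s(s, s)⟩
  obtain ⟨e, he⟩ := exists_subset_singleton hF
  have henc : Function.Injective (msgCode (Option (Option (Sym2 (Fin (N ^ k + 1)))))
      ((2 * k + 3) * Nat.clog 2 N)) :=
    Classical.epsilon_spec (exists_injective_msg (card_option_option_sym2_le hN k))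
  have hrounds := le_roundConst_mul k (Nat.clog_pos one_lt_two hN)
  obtain ⟨d, q, hcfg, hout, hd⟩ :=
    (runExecution (broadcastAlg k N) G ident s m₀ A he).exists_cfg_eq_of_le hident henc
      (edgeName_map_injective hident hle) hG hm v
      ((Nat.mul_le_mul_right _ hrounds).trans ((Nat.mul_right_comm ..).trans_le hr))
  exact ⟨d, ⟨q, hcfg, hout⟩, hd⟩

end AdvCongest

open AdvCongest in
theorem theorem1 :
    -- `a`: the approximation factor of the diameter estimate, an absolute constant
    ∃ a : ℕ,
    -- `k`: the constant in the polynomial bounds on the identifiers and on the estimate of the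
    -- number of nodes, and in the length `O(log n)` of the message
    ∀ k : ℕ,
    -- `B`, `C`: the constants in the bandwidth `O(log n)` and in the round complexity;
    -- `alg N`: the algorithm run by nodes that know the estimate `N` of the number of nodes
    ∃ (B C : ℕ) (alg : (N : ℕ) → Protocol (B * Nat.clog 2 N)),
    ∀ (V : Type) [Fintype V] [Nontrivial V] (G : SimpleGraph V), G.IsEdgeConnected 3 →
    ∀ ident : V → ℕ, Function.Injective ident → (∀ v, ident v ≤ Fintype.card V ^ k) →
    ∀ N : ℕ, Fintype.card V ≤ N → N ≤ Fintype.card V ^ k →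
    ∀ (s : V) (m₀ : List Bool), m₀.length ≤ k * Nat.clog 2 (Fintype.card V) →
    ∀ F : Set (Sym2 V), F ⊆ G.edgeSet → F.encard ≤ 1 →
    ∀ A : Adversary V (B * Nat.clog 2 N),
    ∀ v : V, ∃ d : ℕ,
      HaltedWith G ident (alg N) s m₀ F A
        (C * G.diam ^ 2 * Nat.clog 2 (Fintype.card V) ^ C) v m₀ d ∧
      G.diam ≤ d ∧ d ≤ a * G.diam := by
  refine ⟨52, fun k => ⟨2 * k + 3, (k + 1) * roundConst k, broadcastAlg k, ?_⟩⟩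
  intro V _ _ G hG ident hident hle N hN hN' s m₀ hm F _ hF A v
  exact theorem1_general hG hident (Fintype.one_lt_card.trans_le hN)
    (fun u => (hle u).trans (Nat.pow_le_pow_left hN k)) s
    (hm.trans (Nat.mul_le_mul_left k (Nat.clog_mono_right 2 hN))) hF A
    (roundConst_mul_clog_le hN' _) v
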